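/- Let $M,N\ge 3$ be integers, and let $x\in\{-1,1\}^N$, $y\in\{-1,1\}^M$ be indexed by $\mathbb Z/N\mathbb Z$ and $\mathbb Z/M\mathbb Z$ respectively. The toroidal Hitomezashi pattern $C_{M,N}(x,y)$ is the following orientation of the grid graph on $\mathbb Z/M\mathbb Z\times\mathbb Z/N\mathbb Z$ (in which $(i,j)$ is adjacent to $(i\pm1,j)$ and $(i,j\pm1)$): the edge $\{(i,j),(i+1,j)\}$ is oriented $(i,j)\to(i+1,j)$ if $x_j=1$ and $(i+1,j)\to(i,j)$ if $x_j=-1$; the edge $\{(i,j),(i,j+1)\}$ is oriented $(i,j)\to(i,j+1)$ if $y_i=1$ and $(i,j+1)\to(i,j)$ if $y_i=-1$. A toroidal Hitomezashi loop is a (directed) circuit in $C_{M,N}(x,y)$ whose edges alternate cyclically between horizontal and vertical edges; its length is its number of edges. Let $\Delta x$ be the number of edges $(i,j)\to(i+1,j)$ of the loop minus the number of its edges $(i+1,j)\to(i,j)$, and define $\Delta y$ analogously with the vertical edges. The homology class of the loop is $(\Delta x/M,\Delta y/N)\in\mathbb Z^2$; the loop is trivial if its homology class is $(0,0)$ and nontrivial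 otherwise. Let $k(x)$ be the number of $1$'s minus the number of $-1$'s in $x$. **Theorem (Loop length).** (1) Every trivial toroidal Hitomezashi loop in $C_{M,N}(x,y)$ has length congruent to $4$ modulo $8$. (2) In a symmetric pattern $C_{N,N}(x,x)$, every nontrivial toroidal Hitomezashi loop has length congruent to $2|k(x)|$ modulo $8$. (3) In a general pattern $C_{M,N}(x,y)$, if a nontrivial toroidal Hitomezashi loop has homology class $(\lambda,\mu)$, then its length is congruent to $2(\mu N+\lambda M-\mu k(x))$ modulo $8$. -/

import Mathlib

/-! Hitomezashi patterns and loops on the toroidal grid `ℤ/M × ℤ/N`.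
Elements of `{-1, 1}` are represented by the units `ℤˣ` of `ℤ`; a binary string `x ∈ {-1, 1}^N`
is a function `ZMod N → ℤˣ`. -/

namespace Hitomezashi

variable {M N : ℕ}

/-- The step from `u` to `v` has the form `(i, j) → (i + 1, j)`. -/
abbrev IsRight (u v : ZMod M × ZMod N) : Prop := v = (u.1 + 1, u.2)

/-- The step from `u` to `v` has the form `(i + 1, j) → (i, j)`. -/
abbrev IsLeft (u v : ZMod M × ZMod N) : Prop := u = (v.1 + 1, v.2)

/-- The step from `u` to `v` has the form `(i, j) → (i, j + 1)`. -/
abbrev IsUp (u v : ZMod M × ZMod N) : Prop := v = (u.1, u.2 + 1)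

/-- The step from `u` to `v` has the form `(i, j + 1) → (i, j)`. -/
abbrev IsDown (u v : ZMod M × ZMod N) : Prop := u = (v.1, v.2 + 1)

/-- The step from `u` to `v` runs along a horizontal edge. -/
abbrev IsHorizontal (u v : ZMod M × ZMod N) : Prop := IsRight u v ∨ IsLeft u v

/-- The step from `u` to `v` runs along a vertical edge. -/
abbrev IsVertical (u v : ZMod M × ZMod N) : Prop := IsUp u v ∨ IsDown u v

/-- The toroidal Hitomezashi pattern given by `x` and `y`: the toroidal grid, oriented so that the
horizontal edges at height `j` point to the right if `x j = 1` and to the left if `x j = -1`, and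
the vertical edges at abscissa `i` point up if `y i = 1` and down if `y i = -1`. -/
def pattern (x : ZMod N → ℤˣ) (y : ZMod M → ℤˣ) : Digraph (ZMod M × ZMod N) where
  Adj u v :=
    (IsRight u v ∧ x u.2 = 1) ∨ (IsLeft u v ∧ x u.2 = -1) ∨
      (IsUp u v ∧ y u.1 = 1) ∨ (IsDown u v ∧ y u.1 = -1)

/-- A toroidal Hitomezashi loop: a circuit (a closed directed walk of positive length that repeats
no edge) in the pattern whose edges alternate, cyclically, between horizontal and vertical ones.
The circuit is given by the periodic sequence of its vertices; its edges are the arcs from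
`vertex i` to `vertex (i + 1)` for `i < length`. -/
structure Loop (x : ZMod N → ℤˣ) (y : ZMod M → ℤˣ) where
  length : ℕ
  length_pos : 0 < length
  vertex : ℕ → ZMod M × ZMod N
  periodic : ∀ i, vertex (i + length) = vertex i
  adj : ∀ i, (pattern x y).Adj (vertex i) (vertex (i + 1))
  edges_distinct : Set.InjOn (fun i => (vertex i, vertex (i + 1))) (Set.Iio length)
  alternating : ∀ i, IsHorizontal (vertex i) (vertex (i + 1)) ↔
    IsVertical (vertex (i + 1)) (vertex (i + 2))

namespace Loop

variable {x : ZMod N → ℤˣ} {y : ZMod M → ℤˣ}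

/-- The `x`-shift: the number of edges pointing right minus the number of edges pointing left. -/
def xShift (γ : Loop x y) : ℤ :=
  (((Finset.range γ.length).filter fun i => IsRight (γ.vertex i) (γ.vertex (i + 1))).card : ℤ) -
    (((Finset.range γ.length).filter fun i => IsLeft (γ.vertex i) (γ.vertex (i + 1))).card : ℤ)

/-- The `y`-shift: the number of edges pointing up minus the number of edges pointing down. -/
def yShift (γ : Loop x y) : ℤ :=
  (((Finset.range γ.length).filter fun i => IsUp (γ.vertex i) (γ.vertex (i + 1))).card : ℤ) -
    (((Finset.range γ.length).filter fun i => IsDown (γ.vertex i) (γ.vertex (i + 1))).card : ℤ)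

/-- The homology class `(Δx / M, Δy / N)`. Both divisions are exact, see `xShift_eq` and
`yShift_eq`. -/
def homologyClass (γ : Loop x y) : ℤ × ℤ := (γ.xShift / (M : ℤ), γ.yShift / (N : ℤ))

/-- A loop is trivial if its homology class is `(0, 0)`, and nontrivial otherwise. -/
def IsTrivial (γ : Loop x y) : Prop := γ.homologyClass = (0, 0)

theorem dvd_xShift (hM : 3 ≤ M) (hN : 3 ≤ N) (γ : Loop x y) : (M : ℤ) ∣ γ.xShift := by
  have : Fact (1 < M) := ⟨by omega⟩
  have : Fact (1 < N) := ⟨by omega⟩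
  have h0 : γ.vertex γ.length = γ.vertex 0 := by simpa using γ.periodic 0
  have key : ((γ.xShift : ℤ) : ZMod M) =
      ∑ i ∈ Finset.range γ.length, ((γ.vertex (i + 1)).1 - (γ.vertex i).1) := by
    unfold xShift
    push_cast
    rw [Finset.natCast_card_filter, Finset.natCast_card_filter, ← Finset.sum_sub_distrib]
    refine Finset.sum_congr rfl fun i _ => ?_
    have h2 : (2 : ZMod M) ≠ 0 := by
      intro h
      have := (ZMod.natCast_eq_zero_iff 2 M).1 (by exact_mod_cast h)
      exact absurd (Nat.le_of_dvd (by norm_num) this) (by omega)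
    generalize γ.vertex i = u, γ.vertex (i + 1) = v, γ.adj i = h
    obtain ⟨a, b⟩ := u
    obtain ⟨c, d⟩ := v
    simp only [pattern, IsRight, IsLeft, IsUp, IsDown, Prod.mk.injEq] at h ⊢
    rcases h with ⟨⟨rfl, rfl⟩, -⟩ | ⟨⟨rfl, rfl⟩, -⟩ | ⟨⟨rfl, rfl⟩, -⟩ | ⟨⟨rfl, rfl⟩, -⟩ <;>
      simp [add_assoc, one_add_one_eq_two, h2]
  rw [Finset.sum_range_sub (fun i => (γ.vertex i).1), h0, sub_self] at key
  exact (ZMod.intCast_zmod_eq_zero_iff_dvd _ _).1 key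

theorem dvd_yShift (hM : 3 ≤ M) (hN : 3 ≤ N) (γ : Loop x y) : (N : ℤ) ∣ γ.yShift := by
  have : Fact (1 < M) := ⟨by omega⟩
  have : Fact (1 < N) := ⟨by omega⟩
  have h0 : γ.vertex γ.length = γ.vertex 0 := by simpa using γ.periodic 0
  have key : ((γ.yShift : ℤ) : ZMod N) =
      ∑ i ∈ Finset.range γ.length, ((γ.vertex (i + 1)).2 - (γ.vertex i).2) := by
    unfold yShift
    push_cast
    rw [Finset.natCast_card_filter, Finset.natCast_card_filter, ← Finset.sum_sub_distrib]
    refine Finset.sum_congr rfl fun i _ => ?_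
    have h2 : (2 : ZMod N) ≠ 0 := by
      intro h
      have := (ZMod.natCast_eq_zero_iff 2 N).1 (by exact_mod_cast h)
      exact absurd (Nat.le_of_dvd (by norm_num) this) (by omega)
    generalize γ.vertex i = u, γ.vertex (i + 1) = v, γ.adj i = h
    obtain ⟨a, b⟩ := u
    obtain ⟨c, d⟩ := v
    simp only [pattern, IsRight, IsLeft, IsUp, IsDown, Prod.mk.injEq] at h ⊢
    rcases h with ⟨⟨rfl, rfl⟩, -⟩ | ⟨⟨rfl, rfl⟩, -⟩ | ⟨⟨rfl, rfl⟩, -⟩ | ⟨⟨rfl, rfl⟩, -⟩ <;>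
      simp [add_assoc, one_add_one_eq_two, h2]
  rw [Finset.sum_range_sub (fun i => (γ.vertex i).2), h0, sub_self] at key
  exact (ZMod.intCast_zmod_eq_zero_iff_dvd _ _).1 key

theorem xShift_eq (hM : 3 ≤ M) (hN : 3 ≤ N) (γ : Loop x y) :
    γ.xShift = γ.homologyClass.1 * (M : ℤ) :=
  (Int.ediv_mul_cancel (γ.dvd_xShift hM hN)).symm

theorem yShift_eq (hM : 3 ≤ M) (hN : 3 ≤ N) (γ : Loop x y) :
    γ.yShift = γ.homologyClass.2 * (N : ℤ) :=
  (Int.ediv_mul_cancel (γ.dvd_yShift hM hN)).symm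

end Loop

/-- `k x`: the number of `1`s in `x` minus the number of `-1`s in `x`. -/
def k [NeZero N] (x : ZMod N → ℤˣ) : ℤ :=
  ((Finset.univ.filter fun j => x j = 1).card : ℤ) -
    ((Finset.univ.filter fun j => x j = -1).card : ℤ)

end Hitomezashi

/-! A loop lifts to a lattice path `p` in `ℤ × ℤ` that has `h` horizontal and `h` vertical steps per
period and is invariant under translation by the two shifts. Since no edge repeats on the torus, the
lift of a trivial loop meets itself only after whole periods, and that of a nontrivial loop never
does.

Parity comes from Hopf's secant proof of the Umlaufsatz, modulo 2. The winding parity about the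
origin of the secants `p (t + d) - p t` does not depend on `d` as long as the secants involved are
nonzero. For a closed path the secants over half a period are antipodal after another half period,
so the parity is odd (`winding_one_of_closed`); for a nonzero translation the secants over a full
period are constant, so it is even (`winding_one_of_translation`). At `d = 1` it is the parity of
the number `A` of turns between up and left.

Now `h` is the horizontal shift plus twice the number of left steps. Telescoping along the vertical
steps, the number of left steps is `A` minus the net number of leftward rows climbed. For the class
`(l, m)` this gives length `2 * (l * M + 2 * A - m * (N - k x))` (`Loop.length_eq`), hence the
trivial and the general case.

The symmetric case also needs `l = m` and `l * k x = |k x|` (`Loop.symmetric_class`). The path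
bounces off the diagonals `i - j = q * N`, so `l = m`. Let `F` be a primitive of `x` and give the
unit cell with upper right corner `(a, b)` the value `F a - F b`: the path always has some `c` on
its left and `c + 1` on its right. If `k x > 0`, certain quadrants cornered at points above which
`F` stays larger can be crossed by the path at one boundary edge only, inwards. This forces `l = 1`;
negative drift follows by a point reflection. -/

namespace Hitomezashi

/-! ### Crossing parities and the Umlaufsatz modulo 2 -/

/-- The unit vectors of `ℤ × ℤ`. -/
def IsUnitStep (e : ℤ × ℤ) : Prop :=
  (e.2 = 0 ∧ (e.1 = 1 ∨ e.1 = -1)) ∨ (e.1 = 0 ∧ (e.2 = 1 ∨ e.2 = -1))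

/-- The indicator, modulo 2, of the grid edges that cross the ray `{(a, 1/2) | a < 0}`. -/
def cross (u v : ℤ × ℤ) : ZMod 2 :=
  if u.1 = v.1 ∧ u.1 < 0 ∧ ((u.2 = 0 ∧ v.2 = 1) ∨ (u.2 = 1 ∧ v.2 = 0)) then 1 else 0

/-- The indicator of the half-open upper half plane. -/
def upper (u : ℤ × ℤ) : ZMod 2 := if 0 < u.2 ∨ (u.2 = 0 ∧ 0 < u.1) then 1 else 0

theorem cross_comm (u v : ℤ × ℤ) : cross u v = cross v u := by
  unfold cross
  congr 1
  apply propext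
  omega

/-- The only unit square that the ray meets in a single edge is the one where it ends, and that
square has the origin as a corner. Parallel `e` and `f` give degenerate squares, which are harmless.
-/
theorem cross_square {w e f : ℤ × ℤ} (he : IsUnitStep e) (hf : IsUnitStep f) (h0 : w ≠ 0)
    (h1 : w + f ≠ 0) (h2 : w - e ≠ 0) (h3 : w + f - e ≠ 0) :
    cross w (w + f) + cross (w + f) (w + f - e) =
      cross w (w - e) + cross (w - e) (w + f - e) := by
  obtain ⟨a, b⟩ := w
  obtain ⟨c, d⟩ := e
  obtain ⟨c', d'⟩ := f
  simp only [IsUnitStep, ne_eq, Prod.mk_add_mk, Prod.mk_sub_mk, Prod.mk_eq_zero, not_and,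
    cross] at *
  rcases he with ⟨rfl, rfl | rfl⟩ | ⟨rfl, rfl | rfl⟩ <;>
    rcases hf with ⟨rfl, rfl | rfl⟩ | ⟨rfl, rfl | rfl⟩ <;>
    split_ifs <;> first | rfl | (exfalso; omega)

/-- The boundary of `upper` consists of the ray and its antipode, joined near the origin; a unit
step between nonzero points crosses it only on one of these two rays. -/
theorem cross_add_cross_neg {u v : ℤ × ℤ} (h : IsUnitStep (v - u)) (hu : u ≠ 0) (hv : v ≠ 0) :
    cross u v + cross (-u) (-v) = upper v - upper u := by
  obtain ⟨a, b⟩ := u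
  obtain ⟨c, d⟩ := v
  simp only [IsUnitStep, ne_eq, Prod.mk_sub_mk, Prod.neg_mk, Prod.mk_eq_zero, not_and,
    cross, upper] at *
  split_ifs <;> first | rfl | (exfalso; omega)

theorem upper_neg {u : ℤ × ℤ} (hu : u ≠ 0) : upper (-u) - upper u = 1 := by
  obtain ⟨a, b⟩ := u
  simp only [ne_eq, Prod.neg_mk, Prod.mk_eq_zero, not_and, upper] at *
  split_ifs <;> first | rfl | (exfalso; omega)

theorem IsUnitStep.neg {e : ℤ × ℤ} (h : IsUnitStep e) : IsUnitStep (-e) := by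
  simp only [IsUnitStep, Prod.fst_neg, Prod.snd_neg] at *
  omega

/-- The winding number modulo 2 of the secants of span `d` and `d + 1` of a path `p` over a
period `L`. -/
def winding (p : ℕ → ℤ × ℤ) (L d : ℕ) : ZMod 2 :=
  ∑ t ∈ Finset.range L, (cross (p (t + d) - p t) (p (t + d + 1) - p t) +
    cross (p (t + d + 1) - p t) (p (t + d + 1) - p (t + 1)))

section Winding

variable {p : ℕ → ℤ × ℤ} {L : ℕ}

/-- Advancing the head of a secant first or its tail first gives the two ways around a unit square,
whose corners are secants of spans `d`, `d + 1` and `d + 2`. -/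
theorem upper_stair_eq_lower_stair (hp : ∀ t, IsUnitStep (p (t + 1) - p t)) {d : ℕ}
    (h0 : ∀ t, p (t + d) ≠ p t) (h1 : ∀ t, p (t + (d + 1)) ≠ p t)
    (h2 : ∀ t, p (t + (d + 2)) ≠ p t) (t : ℕ) :
    cross (p (t + (d + 1)) - p t) (p (t + (d + 1) + 1) - p t) +
      cross (p (t + (d + 1) + 1) - p t) (p (t + (d + 1) + 1) - p (t + 1)) =
    cross (p (t + (d + 1)) - p t) (p (t + (d + 1)) - p (t + 1)) +
      cross (p (t + (d + 1)) - p (t + 1)) (p (t + (d + 1) + 1) - p (t + 1)) := by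
  have e1 : p (t + (d + 1) + 1) - p t =
      p (t + (d + 1)) - p t + (p (t + (d + 1) + 1) - p (t + (d + 1))) := by abel
  have e2 : p (t + (d + 1)) - p (t + 1) =
      p (t + (d + 1)) - p t - (p (t + 1) - p t) := by abel
  have e3 : p (t + (d + 1) + 1) - p (t + 1) =
      p (t + (d + 1)) - p t + (p (t + (d + 1) + 1) - p (t + (d + 1))) - (p (t + 1) - p t) := by
    abel
  have := cross_square (w := p (t + (d + 1)) - p t) (hp t) (hp (t + (d + 1)))
    (sub_ne_zero.2 (h1 t)) (by rw [← e1]; exact sub_ne_zero.2 (h2 t))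
    (by rw [← e2, show t + (d + 1) = t + 1 + d by ring]; exact sub_ne_zero.2 (h0 (t + 1)))
    (by rw [← e3, show t + (d + 1) + 1 = t + 1 + (d + 1) by ring]
        exact sub_ne_zero.2 (h1 (t + 1)))
  rwa [← e3, ← e1, ← e2] at this

theorem winding_succ (hp : ∀ t, IsUnitStep (p (t + 1) - p t)) {D : ℤ × ℤ}
    (hL : ∀ t, p (t + L) = p t + D) {d : ℕ} (h0 : ∀ t, p (t + d) ≠ p t)
    (h1 : ∀ t, p (t + (d + 1)) ≠ p t) (h2 : ∀ t, p (t + (d + 2)) ≠ p t) :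
    winding p L (d + 1) = winding p L d := by
  unfold winding
  rw [Finset.sum_congr rfl fun t _ => upper_stair_eq_lower_stair hp h0 h1 h2 t,
    Finset.sum_add_distrib, Finset.sum_add_distrib, add_comm]
  -- The lower staircases of span `d + 1` use the same edges as the upper ones of span `d`, one of
  -- the two families being shifted by one time step; periodicity absorbs the shift.
  have hshift := (Finset.sum_range_succ' (fun t => cross (p (t + d) - p t) (p (t + d + 1) - p t)) L
    ).symm.trans (Finset.sum_range_succ _ L)
  have hper : cross (p (L + d) - p L) (p (L + d + 1) - p L) =
      cross (p (0 + d) - p 0) (p (0 + d + 1) - p 0) := by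
    rw [show L + d = d + L by ring, show d + L + 1 = d + 1 + L by ring, hL, hL, zero_add,
      show p L = p 0 + D by simpa using hL 0]
    simp only [add_sub_add_right_eq_sub]
  rw [hper] at hshift
  have hshift := add_right_cancel hshift
  congr 1
  rw [← hshift]
  refine Finset.sum_congr rfl fun t _ => ?_
  rw [show t + 1 + d = t + (d + 1) by ring]

theorem winding_eq_winding_one (hp : ∀ t, IsUnitStep (p (t + 1) - p t)) {D : ℤ × ℤ}
    (hL : ∀ t, p (t + L) = p t + D) {m : ℕ} (h : ∀ d, 0 < d → d ≤ m + 2 → ∀ t, p (t + d) ≠ p t) :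
    winding p L (m + 1) = winding p L 1 := by
  induction m with
  | zero => rfl
  | succ m ih =>
    rw [← ih fun d h0 h1 => h d h0 (by omega)]
    exact winding_succ hp hL (h _ (by omega) (by omega)) (h _ (by omega) (by omega))
      (h _ (by omega) (by omega))

/-- The Umlaufsatz modulo 2 for a path that is invariant under a translation. -/
theorem winding_one_of_translation (hp : ∀ t, IsUnitStep (p (t + 1) - p t)) {D : ℤ × ℤ}
    (hL0 : 0 < L) (hL : ∀ t, p (t + L) = p t + D) (h : ∀ d, 0 < d → ∀ t, p (t + d) ≠ p t) :
    winding p L 1 = 0 := by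
  obtain ⟨m, rfl⟩ : ∃ m, L = m + 1 := ⟨L - 1, by omega⟩
  rw [← winding_eq_winding_one hp hL (m := m) fun d h0 _ => h d h0]
  refine Finset.sum_eq_zero fun t _ => ?_
  -- Secants of span `L` equal `D`, so each staircase goes out and back along one edge.
  rw [show t + (m + 1) + 1 = t + 1 + (m + 1) by ring, hL, hL, add_sub_cancel_left,
    add_sub_cancel_left, cross_comm, CharTwo.add_self_eq_zero]

/-- The Umlaufsatz modulo 2 for a closed path. -/
theorem winding_one_of_closed (hp : ∀ t, IsUnitStep (p (t + 1) - p t)) {h : ℕ} (hh : 2 ≤ h)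
    (hL : ∀ t, p (t + 2 * h) = p t) (hne : ∀ d, 0 < d → d < 2 * h → ∀ t, p (t + d) ≠ p t) :
    winding p (2 * h) 1 = 1 := by
  obtain ⟨m, rfl⟩ : ∃ m, h = m + 1 := ⟨h - 1, by omega⟩
  rw [← winding_eq_winding_one hp (D := 0) (by simpa using hL) (m := m)
    fun d h0 h1 => hne d h0 (by omega)]
  -- Half a period later the secant is negated and head and tail swap roles. The staircase at `t` is
  -- therefore replaced by the lower one, which is antipodal to the upper one at `t + (m + 1)`.
  have hstep : ∀ t, cross (p (t + (m + 1)) - p t) (p (t + (m + 1) + 1) - p t) +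
      cross (p (t + (m + 1) + 1) - p t) (p (t + (m + 1) + 1) - p (t + 1)) +
      (cross (p (m + 1 + t + (m + 1)) - p (m + 1 + t))
        (p (m + 1 + t + (m + 1) + 1) - p (m + 1 + t)) +
      cross (p (m + 1 + t + (m + 1) + 1) - p (m + 1 + t))
        (p (m + 1 + t + (m + 1) + 1) - p (m + 1 + t + 1))) =
      upper (p (t + 1 + (m + 1)) - p (t + 1)) - upper (p (t + (m + 1)) - p t) := by
    intro t
    rw [upper_stair_eq_lower_stair hp (hne m (by omega) (by omega))
      (hne (m + 1) (by omega) (by omega)) (hne (m + 2) (by omega) (by omega)) t,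
      show m + 1 + t + (m + 1) + 1 = t + 1 + 2 * (m + 1) by ring,
      show m + 1 + t + (m + 1) = t + 2 * (m + 1) by ring, hL, hL,
      show m + 1 + t = t + (m + 1) by ring,
      ← neg_sub (p (t + (m + 1))) (p t), ← neg_sub (p (t + (m + 1))) (p (t + 1)),
      ← neg_sub (p (t + (m + 1) + 1)) (p (t + 1))]
    have n1 := sub_ne_zero.2 (hne (m + 1) (by omega) (by omega) t)
    have n2 := sub_ne_zero.2 (hne m (by omega) (by omega) (t + 1))
    have n3 := sub_ne_zero.2 (hne (m + 1) (by omega) (by omega) (t + 1))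
    rw [show t + 1 + m = t + (m + 1) by ring] at n2
    rw [show t + 1 + (m + 1) = t + (m + 1) + 1 by ring] at n3 ⊢
    have c1 := cross_add_cross_neg (u := p (t + (m + 1)) - p t)
      (v := p (t + (m + 1)) - p (t + 1))
      (by rw [sub_sub_sub_cancel_left, ← neg_sub]; exact (hp t).neg) n1 n2
    have c2 := cross_add_cross_neg (u := p (t + (m + 1)) - p (t + 1))
      (v := p (t + (m + 1) + 1) - p (t + 1))
      (by rw [sub_sub_sub_cancel_right]; exact hp _) n2 n3
    linear_combination c1 + c2
  unfold winding
  rw [two_mul, Finset.sum_range_add, ← Finset.sum_add_distrib,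
    Finset.sum_congr rfl fun t _ => hstep t,
    Finset.sum_range_sub (fun t => upper (p (t + (m + 1)) - p t)), zero_add,
    show m + 1 + (m + 1) = 0 + 2 * (m + 1) by ring, hL, ← neg_sub (p (m + 1))]
  exact upper_neg (sub_ne_zero.2 (by simpa using hne (m + 1) (by omega) (by omega) 0))

end Winding

/-! ### Lifting a loop to the plane -/

theorem sum_range_add_left_of_periodic {A : Type*} [AddCommGroup A] {f : ℕ → A} {h : ℕ}
    (hf : ∀ n, f (n + h) = f n) (n : ℕ) :
    ∑ r ∈ Finset.range h, f (n + r) = ∑ r ∈ Finset.range h, f r := by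
  induction n with
  | zero => simp
  | succ n ih =>
    have := (Finset.sum_range_succ' (fun r => f (n + r)) h).symm.trans
      (Finset.sum_range_succ _ h)
    rw [hf n, add_zero] at this
    rw [← ih, ← add_right_cancel this]
    exact Finset.sum_congr rfl fun r _ => by rw [add_right_comm, add_assoc]

theorem sum_range_two_mul_eq {A : Type*} [AddCommMonoid A] (f : ℕ → A) (h : ℕ) :
    ∑ r ∈ Finset.range (2 * h), f r = ∑ n ∈ Finset.range h, (f (2 * n) + f (2 * n + 1)) := by
  induction h with
  | zero => simp
  | succ h ih =>
    rw [show 2 * (h + 1) = 2 * h + 1 + 1 by ring, Finset.sum_range_succ, Finset.sum_range_succ, ih,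
      Finset.sum_range_succ, add_assoc]

variable {M N : ℕ}

/-- The lift to `ℤ × ℤ` of an alternating path that is periodic up to the translation by
`(Δi, Δj)`: `i n` and `j n` are the coordinates of its `n`-th vertex that is left along a
horizontal edge, and rows and columns are oriented by `X` and `Y`. -/
structure IsLift (X Y : ℤ → ℤ) (h : ℕ) (Δi Δj : ℤ) (i j : ℕ → ℤ) : Prop where
  i_succ : ∀ n, i (n + 1) = i n + X (j n)
  j_succ : ∀ n, j (n + 1) = j n + Y (i (n + 1))
  i_add : ∀ n, i (n + h) = i n + Δi
  j_add : ∀ n, j (n + h) = j n + Δj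

/-- The `±1`-valued function on `ℤ` that lifts a binary string. -/
def lift (x : ZMod N → ℤˣ) (n : ℤ) : ℤ := (x (n : ZMod N) : ℤˣ)

/-- The signed horizontal displacement along the step from `u` to `v`. -/
def horizontalStep (u v : ZMod M × ZMod N) : ℤ :=
  (if IsRight u v then 1 else 0) - (if IsLeft u v then 1 else 0)

/-- The signed vertical displacement along the step from `u` to `v`. -/
def verticalStep (u v : ZMod M × ZMod N) : ℤ :=
  (if IsUp u v then 1 else 0) - (if IsDown u v then 1 else 0)

theorem two_ne_zero_zmod (hM : 3 ≤ M) : (2 : ZMod M) ≠ 0 := by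
  intro h
  have := (ZMod.natCast_eq_zero_iff 2 M).1 (by exact_mod_cast h)
  exact absurd (Nat.le_of_dvd (by norm_num) this) (by omega)

namespace Loop

variable {x : ZMod N → ℤˣ} {y : ZMod M → ℤˣ}

theorem xShift_eq_sum (γ : Loop x y) : γ.xShift =
    ∑ t ∈ Finset.range γ.length, horizontalStep (γ.vertex t) (γ.vertex (t + 1)) := by
  simp only [xShift, horizontalStep, Finset.natCast_card_filter, Finset.sum_sub_distrib]

theorem yShift_eq_sum (γ : Loop x y) : γ.yShift =
    ∑ t ∈ Finset.range γ.length, verticalStep (γ.vertex t) (γ.vertex (t + 1)) := by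
  simp only [yShift, verticalStep, Finset.natCast_card_filter, Finset.sum_sub_distrib]

/-- Because `1 ≠ -1` modulo `M` and `N`, every edge has exactly one of the four directions. -/
theorem step_cases (hM : 3 ≤ M) (hN : 3 ≤ N) (γ : Loop x y) (t : ℕ) :
    (IsHorizontal (γ.vertex t) (γ.vertex (t + 1)) ∧ ¬ IsVertical (γ.vertex t) (γ.vertex (t + 1)) ∧
      horizontalStep (γ.vertex t) (γ.vertex (t + 1)) = (x (γ.vertex t).2 : ℤˣ) ∧
      verticalStep (γ.vertex t) (γ.vertex (t + 1)) = 0 ∧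
      γ.vertex (t + 1) = ((γ.vertex t).1 + ((x (γ.vertex t).2 : ℤˣ) : ℤ), (γ.vertex t).2)) ∨
    (¬ IsHorizontal (γ.vertex t) (γ.vertex (t + 1)) ∧ IsVertical (γ.vertex t) (γ.vertex (t + 1)) ∧
      horizontalStep (γ.vertex t) (γ.vertex (t + 1)) = 0 ∧
      verticalStep (γ.vertex t) (γ.vertex (t + 1)) = (y (γ.vertex t).1 : ℤˣ) ∧
      γ.vertex (t + 1) = ((γ.vertex t).1, (γ.vertex t).2 + ((y (γ.vertex t).1 : ℤˣ) : ℤ))) := by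
  have : Fact (1 < M) := ⟨by omega⟩
  have : Fact (1 < N) := ⟨by omega⟩
  have h2M := two_ne_zero_zmod hM
  have h2N := two_ne_zero_zmod hN
  have hadj := γ.adj t
  generalize γ.vertex t = u, γ.vertex (t + 1) = v at hadj ⊢
  obtain ⟨a, b⟩ := u
  obtain ⟨c, d⟩ := v
  simp only [pattern, IsHorizontal, IsVertical, IsRight, IsLeft, IsUp, IsDown, horizontalStep,
    verticalStep, Prod.mk.injEq] at hadj ⊢
  rcases hadj with ⟨⟨rfl, rfl⟩, h⟩ | ⟨⟨rfl, rfl⟩, h⟩ | ⟨⟨rfl, rfl⟩, h⟩ | ⟨⟨rfl, rfl⟩, h⟩ <;>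
    simp [h, add_assoc, one_add_one_eq_two, h2M, h2N]

theorem isHorizontal_succ (hM : 3 ≤ M) (hN : 3 ≤ N) (γ : Loop x y) (t : ℕ) :
    IsHorizontal (γ.vertex (t + 1)) (γ.vertex (t + 1 + 1)) ↔
      ¬ IsHorizontal (γ.vertex t) (γ.vertex (t + 1)) := by
  have := γ.alternating t
  rcases γ.step_cases hM hN (t + 1) with ⟨h1, h2, -⟩ | ⟨h1, h2, -⟩ <;> tauto

theorem isHorizontal_add_two_mul (hM : 3 ≤ M) (hN : 3 ≤ N) (γ : Loop x y) (t n : ℕ) :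
    IsHorizontal (γ.vertex (t + 2 * n)) (γ.vertex (t + 2 * n + 1)) ↔
      IsHorizontal (γ.vertex t) (γ.vertex (t + 1)) := by
  induction n with
  | zero => rfl
  | succ n ih =>
    rw [← ih, show t + 2 * (n + 1) = t + 2 * n + 1 + 1 by ring, γ.isHorizontal_succ hM hN,
      γ.isHorizontal_succ hM hN, not_not]

theorem even_length (hM : 3 ≤ M) (hN : 3 ≤ N) (γ : Loop x y) : Even γ.length := by
  by_contra hodd
  obtain ⟨m, hm⟩ := Nat.not_even_iff_odd.1 hodd
  have h1 := γ.isHorizontal_succ hM hN (0 + 2 * m)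
  have h2 : γ.vertex γ.length = γ.vertex 0 := by simpa using γ.periodic 0
  rw [γ.isHorizontal_add_two_mul hM hN 0 m, zero_add, ← hm, h2, add_comm γ.length 1,
    γ.periodic 1] at h1
  tauto

theorem exists_horizontal (hM : 3 ≤ M) (hN : 3 ≤ N) (γ : Loop x y) :
    ∃ T, IsHorizontal (γ.vertex T) (γ.vertex (T + 1)) := by
  by_cases h : IsHorizontal (γ.vertex 0) (γ.vertex (0 + 1))
  · exact ⟨0, h⟩
  · exact ⟨0 + 1, (γ.isHorizontal_succ hM hN 0).2 h⟩

theorem vertex_add_mul (γ : Loop x y) (t n : ℕ) : γ.vertex (t + γ.length * n) = γ.vertex t := by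
  induction n with
  | zero => simp
  | succ n ih => rw [mul_add, mul_one, ← add_assoc, γ.periodic, ih]

theorem modEq_of_edge_eq (γ : Loop x y) {s t : ℕ} (h0 : γ.vertex s = γ.vertex t)
    (h1 : γ.vertex (s + 1) = γ.vertex (t + 1)) : s ≡ t [MOD γ.length] := by
  have key : ∀ r, γ.vertex (r % γ.length) = γ.vertex r ∧
      γ.vertex (r % γ.length + 1) = γ.vertex (r + 1) := by
    intro r
    have h := Nat.mod_add_div r γ.length
    refine ⟨by rw [← γ.vertex_add_mul _ (r / γ.length), h], ?_⟩
    rw [← γ.vertex_add_mul _ (r / γ.length), add_right_comm, h]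
  refine γ.edges_distinct (Nat.mod_lt _ γ.length_pos) (Nat.mod_lt _ γ.length_pos) ?_
  simp only [key, h0, h1]

theorem exists_isLift (hM : 3 ≤ M) (hN : 3 ≤ N) (γ : Loop x y) :
    ∃ (h : ℕ) (i j : ℕ → ℤ), γ.length = 2 * h ∧
      IsLift (lift x) (lift y) h γ.xShift γ.yShift i j ∧
      ∀ m n, (i m : ZMod M) = i n → (j m : ZMod N) = j n → m ≡ n [MOD h] := by
  have : NeZero M := ⟨by omega⟩
  have : NeZero N := ⟨by omega⟩
  obtain ⟨h, hh⟩ := (γ.even_length hM hN)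
  rw [← two_mul] at hh
  obtain ⟨T, hT⟩ := γ.exists_horizontal hM hN
  have hH : ∀ n, IsHorizontal (γ.vertex (T + 2 * n)) (γ.vertex (T + 2 * n + 1)) :=
    fun n => (γ.isHorizontal_add_two_mul hM hN T n).2 hT
  have hV : ∀ n, ¬ IsHorizontal (γ.vertex (T + 2 * n + 1)) (γ.vertex (T + 2 * n + 1 + 1)) :=
    fun n => by rw [γ.isHorizontal_succ hM hN, not_not]; exact hH n
  have eH : ∀ n, _ := fun n => (γ.step_cases hM hN (T + 2 * n)).resolve_right fun h => h.1 (hH n)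
  have eV : ∀ n, _ := fun n =>
    (γ.step_cases hM hN (T + 2 * n + 1)).resolve_left fun h => hV n h.1
  let a : ℕ → ℤ := fun n => (x (γ.vertex (T + 2 * n)).2 : ℤˣ)
  let b : ℕ → ℤ := fun n => (y (γ.vertex (T + 2 * n + 1)).1 : ℤˣ)
  let i : ℕ → ℤ := fun n => ((γ.vertex T).1.val : ℤ) + ∑ r ∈ Finset.range n, a r
  let j : ℕ → ℤ := fun n => ((γ.vertex T).2.val : ℤ) + ∑ r ∈ Finset.range n, b r
  have i_succ : ∀ n, i (n + 1) = i n + a n := fun n => by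
    simp only [i, Finset.sum_range_succ, add_assoc]
  have j_succ : ∀ n, j (n + 1) = j n + b n := fun n => by
    simp only [j, Finset.sum_range_succ, add_assoc]
  have hcast : ∀ n, γ.vertex (T + 2 * n) = ((i n : ZMod M), (j n : ZMod N)) := by
    intro n
    induction n with
    | zero => simp [i, j]
    | succ n ih =>
      rw [show T + 2 * (n + 1) = T + 2 * n + 1 + 1 by ring, (eV n).2.2.2.2, i_succ, j_succ]
      simp only [(eH n).2.2.2.2, b, a, Int.cast_add]
      rw [ih]
  have hcast' : ∀ n, (γ.vertex (T + 2 * n + 1)).1 = (i (n + 1) : ZMod M) := by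
    intro n
    rw [(eH n).2.2.2.2, i_succ]
    simp only [a, Int.cast_add, hcast]
  have aper : ∀ n, a (n + h) = a n := fun n => by
    simp only [a]
    rw [mul_add, ← hh, ← add_assoc, γ.periodic]
  have bper : ∀ n, b (n + h) = b n := fun n => by
    simp only [b]
    rw [mul_add, ← hh, ← add_assoc, add_right_comm, γ.periodic]
  have hx : γ.xShift = ∑ r ∈ Finset.range h, a r := by
    rw [γ.xShift_eq_sum, ← sum_range_add_left_of_periodic
      (fun n => by rw [γ.periodic, add_right_comm, γ.periodic]) T, hh, sum_range_two_mul_eq]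
    refine Finset.sum_congr rfl fun n _ => ?_
    rw [← add_assoc T (2 * n) 1, (eH n).2.2.1, (eV n).2.2.1, add_zero]
  have hy : γ.yShift = ∑ r ∈ Finset.range h, b r := by
    rw [γ.yShift_eq_sum, ← sum_range_add_left_of_periodic
      (fun n => by rw [γ.periodic, add_right_comm, γ.periodic]) T, hh, sum_range_two_mul_eq]
    refine Finset.sum_congr rfl fun n _ => ?_
    rw [← add_assoc T (2 * n) 1, (eH n).2.2.2.1, (eV n).2.2.2.1, zero_add]
  refine ⟨h, i, j, hh, ⟨fun n => ?_, fun n => ?_, fun n => ?_, fun n => ?_⟩, fun m n hi hj => ?_⟩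
  · rw [i_succ, lift]
    simp only [a, hcast]
  · rw [j_succ, lift]
    simp only [b, hcast']
  · simp only [i]
    rw [Finset.sum_range_add, sum_range_add_left_of_periodic aper, hx, add_assoc]
  · simp only [j]
    rw [Finset.sum_range_add, sum_range_add_left_of_periodic bper, hy, add_assoc]
  -- The vertex determines the horizontal edge leaving it, so a repeated vertex at such times is a
  -- repeated edge.
  · have h0 : γ.vertex (T + 2 * m) = γ.vertex (T + 2 * n) := by rw [hcast, hcast, hi, hj]
    have := γ.modEq_of_edge_eq h0 (by rw [(eH m).2.2.2.2, (eH n).2.2.2.2, h0])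
    rw [hh] at this
    exact Nat.ModEq.mul_left_cancel' (by norm_num) (Nat.ModEq.add_left_cancel' T this)

end Loop
-- Primitives of periodic functions
theorem exists_primitive (f : ℤ → ℤ) : ∃ F : ℤ → ℤ, ∀ n, F (n + 1) = F n + f n := by
  refine ⟨fun n => match n with
    | .ofNat n => ∑ r ∈ Finset.range n, f r
    | .negSucc n => -∑ r ∈ Finset.range (n + 1), f (Int.negSucc r), fun n => ?_⟩
  match n with
  | .ofNat n => exact Finset.sum_range_succ (fun r : ℕ => f r) n
  | .negSucc 0 => simp
  | .negSucc (n + 1) =>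
    change -∑ r ∈ Finset.range (n + 1), f (Int.negSucc r) =
      -∑ r ∈ Finset.range (n + 1 + 1), f (Int.negSucc r) + f (Int.negSucc (n + 1))
    rw [Finset.sum_range_succ _ (n + 1)]
    ring

theorem primitive_add_mul {N : ℕ} [NeZero N] {g : ZMod N → ℤ} {F : ℤ → ℤ}
    (hF : ∀ n, F (n + 1) = F n + g n) (n m : ℤ) : F (n + m * N) = F n + m * ∑ z, g z := by
  have h1 : ∀ n, F (n + N) = F n + ∑ z, g z := by
    intro n
    have key : ∀ m : ℕ, F (n + m) = F n + ∑ r ∈ Finset.range m, g (n + r) := by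
      intro m
      induction m with
      | zero => simp
      | succ m ih =>
        rw [Finset.sum_range_succ, ← add_assoc, ← ih, Nat.cast_succ, ← add_assoc, hF]
        push_cast
        rfl
    rw [key]
    congr 1
    refine Finset.sum_nbij' (fun r : ℕ => (n : ZMod N) + r) (fun z => (z - n).val) ?_ ?_ ?_ ?_ ?_
    · simp
    · intro z _
      simpa using ZMod.val_lt _
    · intro r hr
      simp [Nat.mod_eq_of_lt (Finset.mem_range.1 hr), ZMod.val_natCast]
    · intro z _
      simp
    · simp
  induction m using Int.induction_on with
  | zero => simp
  | succ m ih => rw [add_mul, one_mul, ← add_assoc, h1, ih]; ring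
  | pred m ih =>
    have := h1 (n + (-m - 1) * N)
    rw [show n + (-(m : ℤ) - 1) * N + N = n + -m * N by ring, ih] at this
    linarith

/-! ### Turns of the lifted path and the length formula -/

namespace IsLift

variable {X Y : ℤ → ℤ} {h : ℕ} {Δi Δj : ℤ} {i j : ℕ → ℤ}

/-- The path in `ℤ × ℤ` with all its vertices. -/
def path (i j : ℕ → ℤ) (t : ℕ) : ℤ × ℤ := (i ((t + 1) / 2), j (t / 2))

theorem path_two_mul (n : ℕ) : path i j (2 * n) = (i n, j n) := by
  unfold path
  congr 2 <;> omega

theorem path_two_mul_add_one (n : ℕ) : path i j (2 * n + 1) = (i (n + 1), j n) := by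
  unfold path
  congr 2 <;> omega

theorem isUnitStep_path (H : IsLift X Y h Δi Δj i j) (hX : ∀ n, X n = 1 ∨ X n = -1)
    (hY : ∀ n, Y n = 1 ∨ Y n = -1) (t : ℕ) :
    IsUnitStep (path i j (t + 1) - path i j t) := by
  obtain ⟨n, rfl | rfl⟩ := Nat.even_or_odd' t
  · rw [path_two_mul_add_one, path_two_mul, H.i_succ]
    simpa [IsUnitStep] using hX (j n)
  · rw [path_two_mul_add_one, show 2 * n + 1 + 1 = 2 * (n + 1) by ring, path_two_mul, H.j_succ]
    simpa [IsUnitStep] using hY (i (n + 1))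

theorem path_add (H : IsLift X Y h Δi Δj i j) (t : ℕ) :
    path i j (t + 2 * h) = path i j t + (Δi, Δj) := by
  unfold path
  rw [show (t + 2 * h + 1) / 2 = (t + 1) / 2 + h by omega,
    show (t + 2 * h) / 2 = t / 2 + h by omega, H.i_add, H.j_add]
  rfl

theorem path_add_mul (H : IsLift X Y h Δi Δj i j) (t r : ℕ) :
    path i j (t + 2 * h * r) = path i j t + r • (Δi, Δj) := by
  induction r with
  | zero => simp
  | succ r ih => rw [mul_add, mul_one, ← add_assoc, H.path_add, ih, succ_nsmul, add_assoc]

theorem two_dvd_of_path_eq (H : IsLift X Y h Δi Δj i j) (hX : ∀ n, X n = 1 ∨ X n = -1)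
    (hY : ∀ n, Y n = 1 ∨ Y n = -1) {t d : ℕ} (hp : path i j (t + d) = path i j t) : 2 ∣ d := by
  have key : ∀ t : ℕ, (2 : ℤ) ∣ (path i j t).1 + (path i j t).2 - i 0 - j 0 - t := by
    intro t
    induction t with
    | zero => simp [path]
    | succ t ih =>
      have := H.isUnitStep_path hX hY t
      simp only [IsUnitStep, Prod.fst_sub, Prod.snd_sub] at this
      push_cast
      omega
  have h1 := key (t + d)
  have h2 := key t
  rw [hp] at h1
  push_cast at h1
  omega

/-- Coordinate-sum parity makes `d` even. At odd times the row determines the horizontal edge just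
traversed, so a coincidence can be moved back to the even time before it. -/
theorem dvd_of_path_eq (H : IsLift X Y h Δi Δj i j) (hX : ∀ n, X n = 1 ∨ X n = -1)
    (hY : ∀ n, Y n = 1 ∨ Y n = -1) (hinj : ∀ m n, i m = i n → j m = j n → m ≡ n [MOD h])
    {t d : ℕ} (hp : path i j (t + d) = path i j t) : 2 * h ∣ d := by
  obtain ⟨r, rfl⟩ := H.two_dvd_of_path_eq hX hY hp
  refine mul_dvd_mul_left 2 ?_
  obtain ⟨n, rfl | rfl⟩ := Nat.even_or_odd' t
  · rw [← mul_add, path_two_mul, path_two_mul, Prod.mk.injEq] at hp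
    simpa using (Nat.modEq_iff_dvd' (Nat.le_add_right n r)).1 (hinj _ _ hp.1 hp.2).symm
  · rw [add_right_comm, ← mul_add, path_two_mul_add_one, path_two_mul_add_one, H.i_succ, H.i_succ,
      Prod.mk.injEq] at hp
    obtain ⟨h1, h2⟩ := hp
    rw [h2] at h1
    simpa using (Nat.modEq_iff_dvd' (Nat.le_add_right n r)).1
      (hinj _ _ (add_right_cancel h1) h2).symm

theorem winding_eq_zero (H : IsLift X Y h Δi Δj i j) (hX : ∀ n, X n = 1 ∨ X n = -1)
    (hY : ∀ n, Y n = 1 ∨ Y n = -1) (hinj : ∀ m n, i m = i n → j m = j n → m ≡ n [MOD h])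
    (hh : 0 < h) (hD : (Δi, Δj) ≠ 0) : winding (path i j) (2 * h) 1 = 0 := by
  refine winding_one_of_translation (H.isUnitStep_path hX hY) (by omega) H.path_add
    fun d hd t hp => ?_
  obtain ⟨r, rfl⟩ := H.dvd_of_path_eq hX hY hinj hp
  rw [H.path_add_mul, add_eq_left, smul_eq_zero] at hp
  rcases hp with rfl | hp
  · simp at hd
  · exact hD hp

theorem winding_eq_one (H : IsLift X Y h 0 0 i j) (hX : ∀ n, X n = 1 ∨ X n = -1)
    (hY : ∀ n, Y n = 1 ∨ Y n = -1) (hinj : ∀ m n, i m = i n → j m = j n → m ≡ n [MOD h])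
    (hh : 0 < h) : winding (path i j) (2 * h) 1 = 1 := by
  refine winding_one_of_closed (H.isUnitStep_path hX hY) ?_
    (fun t => (H.path_add t).trans (add_zero _))
    fun d hd hd' t hp => (Nat.le_of_dvd hd (H.dvd_of_path_eq hX hY hinj hp)).not_gt hd'
  -- With `h = 1` the only horizontal step of the period would have zero displacement.
  by_contra hlt
  obtain rfl : h = 1 := by omega
  have h1 := H.i_add 0
  have h2 := H.i_succ 0
  have h3 := hX (j 0)
  rw [zero_add] at h1 h2
  omega

/-- The number of turns from up to left and from left to up of a lifted path over a period. -/
def upLeftTurns (X Y : ℤ → ℤ) (h : ℕ) (i j : ℕ → ℤ) : ℤ :=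
  ∑ n ∈ Finset.range h, ((if X (j n) = -1 ∧ Y (i (n + 1)) = 1 then 1 else 0) +
    (if X (j (n + 1)) = -1 ∧ Y (i (n + 1)) = 1 then 1 else 0))

/-- The span-one staircase at a turn from `e` to `e'` runs `e`, `e + e'`, `e'`. It meets the ray
only between `(-1, 0)` and `(-1, 1)`, that is, when `e` and `e'` are left and up in some order. -/
theorem winding_eq_upLeftTurns (H : IsLift X Y h Δi Δj i j) (hX : ∀ n, X n = 1 ∨ X n = -1)
    (hY : ∀ n, Y n = 1 ∨ Y n = -1) :
    winding (path i j) (2 * h) 1 = (upLeftTurns X Y h i j : ZMod 2) := by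
  unfold winding upLeftTurns
  rw [sum_range_two_mul_eq]
  push_cast
  refine Finset.sum_congr rfl fun n _ => ?_
  rw [show 2 * n + 1 + 1 + 1 = 2 * (n + 1) + 1 by ring, show 2 * n + 1 + 1 = 2 * (n + 1) by ring,
    path_two_mul_add_one, path_two_mul_add_one, path_two_mul, path_two_mul,
    show i (n + 1 + 1) = _ from H.i_succ (n + 1), H.j_succ n, H.i_succ n]
  have h1 := hX (j n)
  have h2 := hY (i n + X (j n))
  have h3 := hX (j n + Y (i n + X (j n)))
  generalize X (j n + Y (i n + X (j n))) = c at *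
  generalize Y (i n + X (j n)) = b at *
  generalize X (j n) = a at *
  simp only [cross, Prod.mk_sub_mk, add_sub_cancel_left, sub_self]
  rcases h1 with rfl | rfl <;> rcases h2 with rfl | rfl <;> rcases h3 with rfl | rfl <;> simp

theorem half_length_eq (H : IsLift X Y h Δi Δj i j) (hX : ∀ n, X n = 1 ∨ X n = -1)
    (hY : ∀ n, Y n = 1 ∨ Y n = -1) (hper : ∀ n, X (n + Δj) = X n) {G : ℤ → ℤ}
    (hG : ∀ n, G (n + 1) = G n + if X n = -1 then 1 else 0) :
    (h : ℤ) = Δi + 2 * upLeftTurns X Y h i j - 2 * (G (j 0 + Δj) - G (j 0)) := by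
  have hI : Δi = ∑ n ∈ Finset.range h, X (j n) := by
    have h1 : ∀ m, i m = i 0 + ∑ n ∈ Finset.range m, X (j n) := by
      intro m
      induction m with
      | zero => simp
      | succ m ih => rw [H.i_succ, ih, Finset.sum_range_succ, add_assoc]
    have h2 := H.i_add 0
    rw [zero_add, h1] at h2
    exact (add_left_cancel h2).symm
  have hleft : ∑ n ∈ Finset.range h, X (j n) =
      h - 2 * ∑ n ∈ Finset.range h, if X (j n) = -1 then 1 else 0 := by
    rw [Finset.mul_sum, eq_sub_iff_add_eq, ← Finset.sum_add_distrib]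
    trans ∑ n ∈ Finset.range h, (1 : ℤ)
    · refine Finset.sum_congr rfl fun n _ => ?_
      rcases hX (j n) with h | h <;> rw [h] <;> norm_num
    · simp
  have hshift : ∑ n ∈ Finset.range h, (if X (j n) = -1 then (1 : ℤ) else 0) =
      ∑ n ∈ Finset.range h, if X (j (n + 1)) = -1 then (1 : ℤ) else 0 := by
    rw [← sum_range_add_left_of_periodic (f := fun n => if X (j n) = -1 then (1 : ℤ) else 0)
      (fun n => by rw [H.j_add, hper]) 1]
    simp only [add_comm 1]
  -- Termwise: on an up step `G` grows by the indicator of the old row, cancelling the first turn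
  -- count; on a down step no turn is counted and `G` drops by the indicator of the new row.
  have htel : ∑ n ∈ Finset.range h, (if X (j (n + 1)) = -1 then (1 : ℤ) else 0) =
      upLeftTurns X Y h i j - (G (j 0 + Δj) - G (j 0)) := by
    rw [← H.j_add 0, zero_add, ← Finset.sum_range_sub (fun n => G (j n)), upLeftTurns,
      ← Finset.sum_sub_distrib]
    refine Finset.sum_congr rfl fun n _ => ?_
    rw [H.j_succ n]
    rcases hY (i (n + 1)) with h | h <;> rw [h]
    · rw [hG]
      simp
    · have := hG (j n + -1)
      rw [neg_add_cancel_right] at this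
      rw [this]
      simp
  rw [hI, hleft, hshift, htel]
  ring

end IsLift

theorem lift_eq (N : ℕ) (x : ZMod N → ℤˣ) (n : ℤ) : lift x n = 1 ∨ lift x n = -1 := by
  unfold lift
  rcases Int.units_eq_one_or (x n) with h | h <;> simp [h]

theorem k_add_two_mul {N : ℕ} [NeZero N] (x : ZMod N → ℤˣ) :
    k x + 2 * ∑ z, (if ((x z : ℤˣ) : ℤ) = -1 then (1 : ℤ) else 0) = N := by
  unfold k
  rw [Finset.natCast_card_filter, Finset.natCast_card_filter, Finset.mul_sum,
    ← Finset.sum_sub_distrib, ← Finset.sum_add_distrib]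
  trans ∑ z : ZMod N, (1 : ℤ)
  · refine Finset.sum_congr rfl fun z _ => ?_
    rcases Int.units_eq_one_or (x z) with h | h <;> simp [h]
  · simp [ZMod.card]

theorem Loop.length_eq {M N : ℕ} [NeZero N] (hM : 3 ≤ M) (hN : 3 ≤ N) {x : ZMod N → ℤˣ}
    {y : ZMod M → ℤˣ} (γ : Loop x y) {l m : ℤ} (hγ : γ.homologyClass = (l, m)) :
    ∃ A : ℤ, (γ.length : ℤ) = 2 * (l * M + 2 * A - m * (N - k x)) ∧
      (γ.IsTrivial → (A : ZMod 2) = 1) ∧ (¬ γ.IsTrivial → (A : ZMod 2) = 0) := by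
  obtain ⟨h, i, j, hlen, H, hinj⟩ := γ.exists_isLift hM hN
  have hdx := γ.xShift_eq hM hN
  have hdy := γ.yShift_eq hM hN
  rw [hγ] at hdx hdy
  have hh : 0 < h := by have := γ.length_pos; omega
  replace hinj : ∀ m n, i m = i n → j m = j n → m ≡ n [MOD h] := fun m n h1 h2 =>
    hinj m n (by rw [h1]) (by rw [h2])
  obtain ⟨G, hG⟩ := exists_primitive fun n => if lift x n = -1 then 1 else 0
  refine ⟨IsLift.upLeftTurns (lift x) (lift y) h i j, ?_, fun htriv => ?_, fun htriv => ?_⟩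
  · have h1 := H.half_length_eq (lift_eq N x) (lift_eq M y)
      (fun n => by simp [lift, hdy]) hG
    have h2 := primitive_add_mul (N := N) (g := fun z => if ((x z : ℤˣ) : ℤ) = -1 then 1 else 0)
      hG (j 0) m
    rw [hdy, h2, hdx, add_sub_cancel_left] at h1
    rw [hlen, ← k_add_two_mul x]
    push_cast
    linear_combination 2 * h1
  · obtain ⟨rfl, rfl⟩ : l = 0 ∧ m = 0 := by simpa [IsTrivial, hγ] using htriv
    rw [hdx, hdy] at H
    simp only [zero_mul] at H
    rw [← H.winding_eq_upLeftTurns (lift_eq N x) (lift_eq M y)]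
    exact H.winding_eq_one (lift_eq N x) (lift_eq M y) hinj hh
  · rw [← H.winding_eq_upLeftTurns (lift_eq N x) (lift_eq M y)]
    refine H.winding_eq_zero (lift_eq N x) (lift_eq M y) hinj hh fun h0 => htriv ?_
    rw [Prod.mk_eq_zero, hdx, hdy, mul_eq_zero, mul_eq_zero] at h0
    simp only [IsTrivial, hγ, Prod.mk.injEq]
    omega

/-! ### Symmetric patterns: reflection, level curves and records -/

namespace IsLift

section Iterate

variable {X Y : ℤ → ℤ} {h : ℕ} {Δi Δj : ℤ} {i j : ℕ → ℤ}

theorem i_add_mul (H : IsLift X Y h Δi Δj i j) (n r : ℕ) : i (n + h * r) = i n + r * Δi := by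
  induction r with
  | zero => simp
  | succ r ih => rw [mul_add, mul_one, ← add_assoc, H.i_add, ih]; push_cast; ring

theorem j_add_mul (H : IsLift X Y h Δi Δj i j) (n r : ℕ) : j (n + h * r) = j n + r * Δj := by
  induction r with
  | zero => simp
  | succ r ih => rw [mul_add, mul_one, ← add_assoc, H.j_add, ih]; push_cast; ring

end Iterate

variable {X : ℤ → ℤ} {h : ℕ} {Δi Δj : ℤ} {i j : ℕ → ℤ} {N : ℕ}

/-- In a symmetric pattern a path is reflected at the diagonals `i - j = q * N`. -/
theorem exists_strip (H : IsLift X X h Δi Δj i j) (hX : ∀ n, X n = 1 ∨ X n = -1) (hN : 0 < N)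
    (hper : ∀ n q : ℤ, X (n + q * N) = X n) :
    ∃ q : ℤ, ∀ n, (q * N ≤ i n - j n ∧ i n - j n ≤ (q + 1) * N) ∧
      (q * N ≤ i (n + 1) - j n ∧ i (n + 1) - j n ≤ (q + 1) * N) := by
  have hrefl : ∀ a b q : ℤ, a - b = q * N → X a = X b := fun a b q hab => by
    rw [← hper b q, ← hab, add_sub_cancel]
  have hNz : (0 : ℤ) < N := by exact_mod_cast hN
  -- The first step changes `i - j` by one; rounding down from the smaller of its two values places
  -- both in the closed strip.
  refine ⟨min (i 0 - j 0) (i 1 - j 0) / N, fun n => ?_⟩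
  set q : ℤ := min (i 0 - j 0) (i 1 - j 0) / N
  induction n with
  | zero =>
    have h1 : q * N ≤ min (i 0 - j 0) (i 1 - j 0) := Int.ediv_mul_le _ hNz.ne'
    have h2 : min (i 0 - j 0) (i 1 - j 0) < (q + 1) * N := Int.lt_ediv_add_one_mul_self _ hNz
    have h3 := H.i_succ 0
    have h4 := hX (j 0)
    rw [zero_add] at h3 ⊢
    generalize q * N = u at *
    generalize (q + 1) * N = v at *
    omega
  | succ n ih =>
    -- On a bounding diagonal row and column have the same sign, so a horizontal step and the next
    -- vertical one change `i - j` in opposite directions: the path bounces back.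
    have r1 := hrefl (i (n + 1)) (j n) q
    have r2 := hrefl (i (n + 1)) (j n) (q + 1)
    have r3 := hrefl (i (n + 1)) (j (n + 1)) q
    have r4 := hrefl (i (n + 1)) (j (n + 1)) (q + 1)
    have h1 := H.i_succ n
    have h2 := H.j_succ n
    have h3 := H.i_succ (n + 1)
    have h4 := hX (j n)
    have h5 := hX (i (n + 1))
    have h6 := hX (j (n + 1))
    generalize q * N = u at *
    generalize (q + 1) * N = v at *
    omega

theorem shift_eq_shift (H : IsLift X X h Δi Δj i j) (hX : ∀ n, X n = 1 ∨ X n = -1) (hN : 0 < N)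
    (hper : ∀ n q : ℤ, X (n + q * N) = X n) : Δi = Δj := by
  obtain ⟨q, hq⟩ := H.exists_strip hX hN hper
  have h0 := (hq 0).1
  -- After `N + 1` periods a nonzero difference of the shifts would exceed the strip width `N`.
  have h1 := (hq (0 + h * (N + 1))).1
  rw [H.i_add_mul, H.j_add_mul] at h1
  push_cast at h1
  have hNz : (0 : ℤ) < N := by exact_mod_cast hN
  rcases lt_trichotomy Δi Δj with hlt | heq | hgt
  · nlinarith
  · exact heq
  · nlinarith

section Record

variable {F : ℤ → ℤ}

/-- The path is a level curve of `(a, b) ↦ F a - F b`, where `F` is a primitive of `X`. -/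
theorem level_eq (H : IsLift X X h Δi Δj i j) (hX : ∀ n, X n = 1 ∨ X n = -1)
    (hF : ∀ n, F (n + 1) = F n + X n) : ∃ c : ℤ, ∀ n,
      2 * F (i n) + X (i n) - 2 * F (j n) - X (j n) + X (i n) * X (j n) = 2 * c + 1 ∧
      2 * F (i (n + 1)) + X (i (n + 1)) - 2 * F (j n) - X (j n) - X (i (n + 1)) * X (j n) =
        2 * c + 1 := by
  have hpred : ∀ n, F n = F (n + -1) + X (n + -1) := fun n => by
    rw [← hF, neg_add_cancel_right]
  have horizontal : ∀ n, 2 * F (i (n + 1)) + X (i (n + 1)) - X (i (n + 1)) * X (j n) =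
      2 * F (i n) + X (i n) + X (i n) * X (j n) := fun n => by
    rw [H.i_succ]
    rcases hX (j n) with h | h <;> rw [h]
    · linarith [hF (i n)]
    · linarith [hpred (i n)]
  have vertical : ∀ n, 2 * F (j (n + 1)) + X (j (n + 1)) - X (i (n + 1)) * X (j (n + 1)) =
      2 * F (j n) + X (j n) + X (i (n + 1)) * X (j n) := fun n => by
    rw [H.j_succ]
    rcases hX (i (n + 1)) with h | h <;> rw [h]
    · linarith [hF (j n)]
    · linarith [hpred (j n)]
  obtain ⟨c, hc⟩ : ∃ c, 2 * F (i 0) + X (i 0) - 2 * F (j 0) - X (j 0) + X (i 0) * X (j 0) =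
      2 * c + 1 := by
    rcases hX (i 0) with h1 | h1 <;> rcases hX (j 0) with h2 | h2 <;> rw [h1, h2]
    · exact ⟨F (i 0) - F (j 0), by ring⟩
    · exact ⟨F (i 0) - F (j 0), by ring⟩
    · exact ⟨F (i 0) - F (j 0) - 2, by ring⟩
    · exact ⟨F (i 0) - F (j 0), by ring⟩
  refine ⟨c, fun n => ?_⟩
  induction n with
  | zero => exact ⟨hc, by linarith [horizontal 0]⟩
  | succ n ih =>
    have := vertical n
    have := horizontal (n + 1)
    constructor <;> linarith [ih.2]

end Record

end IsLift

/-- `F` stays above `F a` to the right of `a`. -/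
def IsRecord (F : ℤ → ℤ) (a : ℤ) : Prop := ∀ n, a < n → F a < F n

section Record

variable {X F : ℤ → ℤ} {N : ℕ} {k : ℤ}

theorem IsRecord.eq_one {a : ℤ} (ha : IsRecord F a) (hX : ∀ n, X n = 1 ∨ X n = -1)
    (hF : ∀ n, F (n + 1) = F n + X n) : X a = 1 := by
  have := ha (a + 1) (by omega)
  have := hF a
  have := hX a
  omega

theorem IsRecord.add_mul {a : ℤ} (ha : IsRecord F a)
    (hk : ∀ n q : ℤ, F (n + q * N) = F n + q * k) (q : ℤ) : IsRecord F (a + q * N) := by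
  intro n hn
  have := ha (n - q * N) (by linarith)
  have := hk (n - q * N) q
  rw [sub_add_cancel] at this
  linarith [hk a q]

theorem exists_record (hX : ∀ n, X n = 1 ∨ X n = -1) (hF : ∀ n, F (n + 1) = F n + X n)
    (hN : 0 < N) (hk0 : 0 < k) (hk : ∀ n q : ℤ, F (n + q * N) = F n + q * k) (m : ℤ) :
    ∃ a, F a = m ∧ IsRecord F a := by
  have hNz : (0 : ℤ) < N := by exact_mod_cast hN
  have hlip : ∀ a : ℕ, F 0 - a ≤ F a := by
    intro a
    induction a with
    | zero => simp
    | succ a ih =>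
      have := hX a
      have := hF a
      push_cast
      omega
  -- The residue of `n` lowers `F` by less than `N`, while each full period raises it by `k ≥ 1`.
  -- The last point with `F n ≤ m` then has value exactly `m`, as steps are `±1`.
  have hbdd : ∃ b : ℤ, ∀ n, F n ≤ m → n ≤ b := by
    refine ⟨(|m - F 0 + N| + 1) * N, fun n hn => ?_⟩
    by_contra! hlt
    have h1 := Int.emod_add_mul_ediv n N
    have h2 := Int.emod_nonneg n hNz.ne'
    have h3 := Int.emod_lt_of_pos n hNz
    have h4 := hlip (n % N).toNat
    rw [Int.toNat_of_nonneg h2] at h4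
    have h5 := hk (n % N) (n / N)
    rw [mul_comm, h1] at h5
    have h6 : |m - F 0 + N| < n / N := by
      by_contra! hle
      nlinarith
    have h7 := le_abs_self (m - F 0 + N)
    have h8 := abs_nonneg (m - F 0 + N)
    nlinarith
  have hne : ∃ n, F n ≤ m := by
    refine ⟨0 + -(|F 0 - m|) * N, ?_⟩
    rw [hk]
    nlinarith [le_abs_self (F 0 - m), abs_nonneg (F 0 - m)]
  obtain ⟨a, ha, hmax⟩ := Int.exists_greatest_of_bdd hbdd hne
  have hgt : ∀ n, a < n → m < F n := fun n hn => by
    by_contra! hle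
    exact (hmax n hle).not_gt hn
  have h1 := hgt (a + 1) (by omega)
  have h2 := hF a
  have h3 := hX a
  obtain rfl : F a = m := by omega
  exact ⟨a, rfl, hgt⟩

end Record

namespace IsLift

section Quadrant

variable {X F : ℤ → ℤ} {h : ℕ} {Δi Δj : ℤ} {i j : ℕ → ℤ} {c a b : ℤ}

/-- An edge crossed by the path has cell values `c` and `c + 1` on its sides. The record at `a`
excludes this on the whole bottom side of the quadrant, and the record at `b` excludes an outward
crossing of the left side. -/
theorem mem_quadrant_succ (H : IsLift X X h Δi Δj i j) (hX : ∀ n, X n = 1 ∨ X n = -1)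
    (hF : ∀ n, F (n + 1) = F n + X n) (ha : IsRecord F a) (hb : IsRecord F b)
    (hab : F a = F b + c + 1) {n : ℕ}
    (hc1 : 2 * F (i n) + X (i n) - 2 * F (j n) - X (j n) + X (i n) * X (j n) = 2 * c + 1)
    (hc2 : 2 * F (i (n + 1)) + X (i (n + 1)) - 2 * F (j n) - X (j n) - X (i (n + 1)) * X (j n) =
        2 * c + 1) (hn : a ≤ i n ∧ b ≤ j n) : a ≤ i (n + 1) ∧ b ≤ j (n + 1) := by
  have hXa := ha.eq_one hX hF
  have hXb := hb.eq_one hX hF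
  have h1 := H.i_succ n
  have h2 := H.j_succ n
  have h3 := hX (j n)
  have hi : a ≤ i (n + 1) := by
    by_contra! hlt
    have h4 : i n = a := by omega
    have h5 : X (j n) = -1 := by omega
    rw [h4, hXa, h5] at hc1
    rcases hn.2.eq_or_lt with h6 | h6
    · rw [← h6] at h5; omega
    · have := hb (j n + 1) (by omega)
      have := hF (j n)
      omega
  refine ⟨hi, ?_⟩
  by_contra! hlt
  have h3 := hX (i (n + 1))
  have h4 : j n = b := by omega
  have h5 : X (i (n + 1)) = -1 := by omega
  rw [h4, hXb, h5] at hc2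
  rcases hi.eq_or_lt with h6 | h6
  · rw [← h6] at h5; omega
  · have := ha _ h6; omega

/-- A rightward crossing of the left side in row `j` needs `F j = F b`, and the record at `b` leaves
only `j = b`. -/
theorem eq_of_enter_quadrant (H : IsLift X X h Δi Δj i j) (hX : ∀ n, X n = 1 ∨ X n = -1)
    (hF : ∀ n, F (n + 1) = F n + X n) (ha : IsRecord F a) (hb : IsRecord F b)
    (hab : F a = F b + c + 1) {n : ℕ}
    (hc2 : 2 * F (i (n + 1)) + X (i (n + 1)) - 2 * F (j n) - X (j n) - X (i (n + 1)) * X (j n) =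
        2 * c + 1) (hn : ¬ (a ≤ i n ∧ b ≤ j n)) (hn' : a ≤ i (n + 1) ∧ b ≤ j (n + 1)) :
    i n = a - 1 ∧ j n = b := by
  have hXa := ha.eq_one hX hF
  have hXb := hb.eq_one hX hF
  have h1 := H.i_succ n
  have h2 := H.j_succ n
  have h3 := hX (j n)
  have h4 := hX (i (n + 1))
  by_cases hj : b ≤ j n
  · have h5 : i (n + 1) = a := by omega
    have h6 : X (j n) = 1 := by omega
    rw [h5, hXa, h6] at hc2
    refine ⟨by omega, ?_⟩
    rcases hj.eq_or_lt with h7 | h7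
    · exact h7.symm
    · have := hb _ h7; omega
  · exfalso
    have h5 : X (i (n + 1)) = 1 := by omega
    have h6 := hF (j n)
    rw [show j n + 1 = b by omega] at h6
    rw [h5] at hc2
    rcases hn'.1.eq_or_lt with h7 | h7
    · rw [← h7] at hc2; omega
    · have := ha _ h7; omega

end Quadrant

variable {X F : ℤ → ℤ} {h : ℕ} {l : ℤ} {i j : ℕ → ℤ} {N : ℕ} {k : ℤ}

/-- In a symmetric pattern with a positive drift, a path that is invariant under a translation
along the diagonal crosses the boundary of suitable quadrants exactly once, and inwards. -/
theorem eq_one_of_pos_drift (H : IsLift X X h (l * N) (l * N) i j) (hl : l ≠ 0)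
    (hX : ∀ n, X n = 1 ∨ X n = -1) (hF : ∀ n, F (n + 1) = F n + X n) (hN : 0 < N) (hk0 : 0 < k)
    (hk : ∀ n q : ℤ, F (n + q * N) = F n + q * k)
    (hinj : ∀ m n, (i m : ZMod N) = i n → (j m : ZMod N) = j n → m ≡ n [MOD h]) : l = 1 := by
  have hNz : (1 : ℤ) ≤ N := by exact_mod_cast hN
  obtain ⟨c, hc⟩ := H.level_eq hX hF
  obtain ⟨b, -, hb⟩ := exists_record hX hF hN hk0 hk 0
  obtain ⟨a, hFa, ha⟩ := exists_record hX hF hN hk0 hk (F b + c + 1)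
  have ha' := ha.add_mul hk
  have hb' := hb.add_mul hk
  have hab : ∀ q : ℤ, F (a + q * N) = F (b + q * N) + c + 1 := fun q => by
    rw [hk, hk, hFa]; ring
  rcases hl.lt_or_gt with hneg | hpos
  · exfalso
    -- This quadrant contains the starting point, so the path stays in it forever, although a
    -- negative `l` carries it arbitrarily far left.
    let q : ℤ := -(|a - i 0| + |b - j 0|)
    have hq : ∀ n, a + q * N ≤ i n ∧ b + q * N ≤ j n := by
      intro n
      induction n with
      | zero =>
        have h1 := le_abs_self (a - i 0)
        have h2 := le_abs_self (b - j 0)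
        have h3 := abs_nonneg (a - i 0)
        have h4 := abs_nonneg (b - j 0)
        have h5 : q * N ≤ q * 1 := mul_le_mul_of_nonpos_left hNz (by simp only [q]; omega)
        simp only [q] at *
        omega
      | succ n ih => exact H.mem_quadrant_succ hX hF (ha' q) (hb' q) (hab q) (hc n).1 (hc n).2 ih
    have h1 := (hq (0 + h * (i 0 - (a + q * N) + 1).toNat)).1
    rw [H.i_add_mul, Int.toNat_of_nonneg (by linarith [(hq 0).1])] at h1
    have h2 : l * N ≤ -1 := by nlinarith
    nlinarith [(hq 0).1]
  · have henter : ∀ q : ℤ, i 0 < a + q * N → ∃ n, i n = a + q * N - 1 ∧ j n = b + q * N := by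
      intro q hq
      by_contra! hne
      have hout : ∀ n, ¬ (a + q * N ≤ i n ∧ b + q * N ≤ j n) := by
        intro n
        induction n with
        | zero => omega
        | succ n ih =>
          intro hn
          obtain ⟨h1, h2⟩ :=
            H.eq_of_enter_quadrant hX hF (ha' q) (hb' q) (hab q) (hc n).2 ih hn
          exact hne n h1 h2
      have h0 : 0 ≤ |a + q * N - i 0| + |b + q * N - j 0| := by positivity
      have h1 := hout (0 + h * (|a + q * N - i 0| + |b + q * N - j 0|).toNat)
      rw [H.i_add_mul, H.j_add_mul, Int.toNat_of_nonneg h0] at h1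
      have h2 : 1 ≤ l * N := by nlinarith
      have h3 := le_mul_of_one_le_right h0 h2
      have := le_abs_self (a + q * N - i 0)
      have := le_abs_self (b + q * N - j 0)
      have := abs_nonneg (a + q * N - i 0)
      have := abs_nonneg (b + q * N - j 0)
      omega
    let q : ℤ := |i 0 - a| + 1
    have hq : i 0 < a + q * N := by
      have h1 := le_abs_self (i 0 - a)
      have h2 := abs_nonneg (i 0 - a)
      have h3 : q * 1 ≤ q * N := mul_le_mul_of_nonneg_left hNz (by simp only [q]; omega)
      simp only [q] at *
      omega
    -- The entries into two consecutive translated quadrants project to one edge of the torus. They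
    -- are thus `r` periods apart with `r * l = 1`.
    obtain ⟨n, hi, hj⟩ := henter q hq
    obtain ⟨n', hi', hj'⟩ := henter (q + 1) (by linarith)
    have hmod : n ≡ n' [MOD h] := hinj n n' (by simp [hi, hi']) (by simp [hj, hj'])
    rcases le_total n n' with hle | hle
    · obtain ⟨r, hr⟩ := (Nat.modEq_iff_dvd' hle).1 hmod
      obtain rfl : n' = n + h * r := by omega
      rw [H.i_add_mul, hi] at hi'
      have h1 : ((r : ℤ) * l) * N = 1 * N := by linarith
      exact Int.eq_one_of_mul_eq_one_left hpos.le (mul_right_cancel₀ (by omega) h1)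
    · obtain ⟨r, hr⟩ := (Nat.modEq_iff_dvd' hle).1 hmod.symm
      obtain rfl : n = n' + h * r := by omega
      rw [H.i_add_mul, hi'] at hi
      nlinarith [mul_nonneg (Int.natCast_nonneg r) hpos.le]

theorem neg {Δi Δj : ℤ} (H : IsLift X X h Δi Δj i j) :
    IsLift (fun n => -X (-n)) (fun n => -X (-n)) h (-Δi) (-Δj) (fun n => -i n) (fun n => -j n) where
  i_succ n := by rw [H.i_succ, neg_neg, neg_add]
  j_succ n := by rw [H.j_succ, neg_neg, neg_add]
  i_add n := by rw [H.i_add, neg_add]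
  j_add n := by rw [H.j_add, neg_add]

theorem mul_drift_eq_abs (H : IsLift X X h (l * N) (l * N) i j) (hl : l ≠ 0)
    (hX : ∀ n, X n = 1 ∨ X n = -1) (hF : ∀ n, F (n + 1) = F n + X n) (hN : 0 < N)
    (hk : ∀ n q : ℤ, F (n + q * N) = F n + q * k)
    (hinj : ∀ m n, (i m : ZMod N) = i n → (j m : ZMod N) = j n → m ≡ n [MOD h]) :
    l * k = |k| := by
  rcases lt_trichotomy k 0 with hk0 | rfl | hk0
  · have H' := H.neg
    rw [← neg_mul] at H'
    -- The increment of `F (1 - n)` at `n` is `F (-n) - F (1 - n) = -X (-n)`, as the reflected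
    -- pattern requires.
    have := H'.eq_one_of_pos_drift (F := fun n => F (1 - n)) (k := -k) (neg_ne_zero.2 hl)
      (fun n => by have := hX (-n); omega)
      (fun n => by
        have := hF (-n)
        rw [show 1 - (n + 1) = -n by ring, show 1 - n = -n + 1 by ring]
        omega)
      hN (by omega)
      (fun n q => by
        have := hk (1 - n) (-q)
        rw [show 1 - (n + q * N) = 1 - n + -q * N by ring, this]
        ring)
      (fun m n h1 h2 => hinj m n (by simpa using h1) (by simpa using h2))
    rw [abs_of_neg hk0, show l = -1 by omega, neg_one_mul]
  · simp
  · rw [H.eq_one_of_pos_drift hl hX hF hN hk0 hk hinj, one_mul, abs_of_pos hk0]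

end IsLift

theorem k_eq_sum {N : ℕ} [NeZero N] (x : ZMod N → ℤˣ) : k x = ∑ z, ((x z : ℤˣ) : ℤ) := by
  unfold k
  rw [Finset.natCast_card_filter, Finset.natCast_card_filter, ← Finset.sum_sub_distrib]
  refine Finset.sum_congr rfl fun z _ => ?_
  rcases Int.units_eq_one_or (x z) with h | h <;> simp [h]

theorem Loop.symmetric_class {N : ℕ} [NeZero N] (hN : 3 ≤ N) {x : ZMod N → ℤˣ} (γ : Loop x x)
    {l m : ℤ} (hγ : γ.homologyClass = (l, m)) (hnt : ¬ γ.IsTrivial) :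
    l = m ∧ l * k x = |k x| := by
  obtain ⟨h, i, j, -, H, hinj⟩ := γ.exists_isLift hN hN
  have hdx := γ.xShift_eq hN hN
  have hdy := γ.yShift_eq hN hN
  rw [hγ] at hdx hdy
  rw [hdx, hdy] at H
  simp only at H
  obtain rfl : l = m := by
    have := H.shift_eq_shift (N := N) (lift_eq N x) (by omega) (fun n q => by simp [lift])
    exact mul_right_cancel₀ (by positivity) this
  refine ⟨rfl, ?_⟩
  obtain ⟨F, hF⟩ := exists_primitive (lift x)
  have hk := primitive_add_mul (N := N) (g := fun z => ((x z : ℤˣ) : ℤ)) hF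
  rw [← k_eq_sum] at hk
  refine H.mul_drift_eq_abs (fun h0 => hnt ?_) (lift_eq N x) hF (by omega) hk hinj
  rw [IsTrivial, hγ, h0]

end Hitomezashi

/-! ### The three congruences -/

theorem theorem2 :
    -- trivial loops
    (∀ (M N : ℕ), 3 ≤ M → 3 ≤ N →
      ∀ (x : ZMod N → ℤˣ) (y : ZMod M → ℤˣ) (γ : Hitomezashi.Loop x y),
        γ.IsTrivial → γ.length ≡ 4 [MOD 8]) ∧
    -- nontrivial loops in a symmetric pattern
    (∀ (N : ℕ) [NeZero N], 3 ≤ N →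
      ∀ (x : ZMod N → ℤˣ) (γ : Hitomezashi.Loop x x),
        ¬ γ.IsTrivial → (γ.length : ℤ) ≡ 2 * |Hitomezashi.k x| [ZMOD 8]) ∧
    -- nontrivial loops in a general pattern
    (∀ (M N : ℕ) [NeZero N], 3 ≤ M → 3 ≤ N →
      ∀ (x : ZMod N → ℤˣ) (y : ZMod M → ℤˣ) (γ : Hitomezashi.Loop x y) (l m : ℤ),
        ¬ γ.IsTrivial → γ.homologyClass = (l, m) →
          (γ.length : ℤ) ≡ 2 * (m * N + l * M - m * Hitomezashi.k x) [ZMOD 8]) := by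
  refine ⟨fun M N hM hN x y γ hγ => ?_, fun N _ hN x γ hγ => ?_,
    fun M N _ hM hN x y γ l m hγ hlm => ?_⟩
  · have : NeZero N := ⟨by omega⟩
    obtain ⟨A, hA, h1, -⟩ := γ.length_eq hM hN hγ
    obtain ⟨B, hB⟩ := (ZMod.intCast_eq_intCast_iff_dvd_sub 1 A 2).1 (by simpa using (h1 hγ).symm)
    push_cast at hB
    rw [← Int.natCast_modEq_iff, hA]
    refine (Int.modEq_iff_dvd.2 ⟨B, ?_⟩).symm
    push_cast
    linear_combination 4 * hB
  · obtain ⟨A, hA, -, h1⟩ := γ.length_eq hN hN (l := γ.homologyClass.1) (m := γ.homologyClass.2) rfl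
    obtain ⟨h2, h3⟩ := γ.symmetric_class hN (l := γ.homologyClass.1) (m := γ.homologyClass.2) rfl hγ
    obtain ⟨B, rfl⟩ := (ZMod.intCast_zmod_eq_zero_iff_dvd A 2).1 (h1 hγ)
    -- With equal sides and `l = m`, the part `l * N - m * (N - k x)` collapses to `l * k x`.
    rw [hA, ← h2, ← h3]
    refine (Int.modEq_iff_dvd.2 ⟨B, ?_⟩).symm
    push_cast
    ring
  · obtain ⟨A, hA, -, h1⟩ := γ.length_eq hM hN hlm
    obtain ⟨B, rfl⟩ := (ZMod.intCast_zmod_eq_zero_iff_dvd A 2).1 (h1 hγ)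
    have hk := Hitomezashi.k_add_two_mul x
    generalize (∑ z, if ((x z : ℤˣ) : ℤ) = -1 then (1 : ℤ) else 0) = q at hk
    rw [hA]
    -- Passing from `-m * (N - k x)` to `m * (N - k x)` costs `4 * m * (N - k x) = 8 * m * q`, with
    -- `q` the number of entries `-1`.
    refine (Int.modEq_iff_dvd.2 ⟨B - m * q, ?_⟩).symm
    push_cast
    linear_combination 4 * m * hk
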